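/- Let $X$ and $Y$ be complex Banach spaces with open unit balls $B_X$ and $B_Y$. Let $\mathcal H^\infty(B_X)$ be the Banach algebra of bounded holomorphic functions $B_X\to\mathbb C$ with the supremum norm (and similarly $\mathcal H^\infty(B_Y)$), and let $\mathcal H_b(X)$ be the Fréchet algebra of holomorphic functions $X\to\mathbb C$ that are bounded on bounded sets, with the topology given by the seminorms $f\mapsto\sup_{\|x\|<R}|f(x)|$, $R>0$. Write $\|f\|_{rB_X}=\sup_{x\in rB_X}|f(x)|$, where $rB_X=\{rx: x\in B_X\}$. Put $$\mathcal M_\infty(B_X,B_Y)=\{\Psi:\mathcal H^\infty(B_X)\to\mathcal H^\infty(B_Y)\ \text{algebra homomorphism}\}\setminus\{0\},$$ $$\mathcal M_{b,\infty}(X,B_Y)=\{\Phi:\mathcal H_b(X)\to\mathcal H^\infty(B_Y)\ \text{continuous algebra homomorphism}\}\setminus\{0\}.$$ Let $\varrho:\mathcal M_\infty(B_X,B_Y)\to\mathcal M_{b,\infty}(X,B_Y)$ be the map given by restriction to $\mathcal H_b(X)$, that is, $\varrho(\Psi)(f)=\Psi(f|_{B_X})$ for $f\in\mathcal H_b(X)$.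 For $\Phi\in\mathcal M_{b,\infty}(X,B_Y)$ let $$R(\Phi)=\inf\{r>0:\ \|\Phi(f)\|\le\|f\|_{rB_X}\ \text{for all } f\in\mathcal H_b(X)\},$$ and for $\Psi\in\mathcal M_\infty(B_X,B_Y)$ let $R(\Psi)$ be the smallest $r\in[0,1]$ such that $\Psi$ is continuous with respect to $\|\cdot\|_{rB_X}$, i.e. such that for some constant $C$ one has $\|\Psi(f)\|\le C\|f\|_{rB_X}$ for all $f\in\mathcal H^\infty(B_X)$. Theorem. The image of $\varrho$ is exactly the set of $\Phi\in\mathcal M_{b,\infty}(X,B_Y)$ with $R(\Phi)\le 1$. Moreover, $\varrho$ restricts to a bijection from $\{\Psi\in\mathcal M_\infty(B_X,B_Y): R(\Psi)<1\}$ onto $\{\Phi\in\mathcal M_{b,\infty}(X,B_Y): R(\Phi)<1\}$. -/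

import Mathlib

noncomputable section

open Metric Set Topology Bornology
open scoped Pointwise BoundedContinuousFunction

namespace VectorSpectrum

/-- `sup_{x ∈ s} |f x|`. It is only used for nonempty `s` and for `f` bounded on `s`. -/
def supOn {α : Type*} (s : Set α) (f : α → ℂ) : ℝ := sSup ((fun x => ‖f x‖) '' s)

section Algebras

variable (E : Type*) [NormedAddCommGroup E] [NormedSpace ℂ E]

/-- The algebra `H^∞(B_E)` of bounded holomorphic functions on the open unit ball `B_E` of `E`,
as a subalgebra of the algebra of bounded continuous functions on `B_E`; in particular it carries
the supremum norm. (A holomorphic function is continuous.) -/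
def HInf : Subalgebra ℂ (ball (0 : E) 1 →ᵇ ℂ) where
  carrier := {f | ∃ F : E → ℂ, DifferentiableOn ℂ F (ball 0 1) ∧ ∀ x : ball (0 : E) 1, F x = f x}
  mul_mem' := by
    rintro f g ⟨F, hF, hFf⟩ ⟨G, hG, hGg⟩
    exact ⟨fun x => F x * G x, hF.mul hG, fun x => by simp [hFf, hGg]⟩
  add_mem' := by
    rintro f g ⟨F, hF, hFf⟩ ⟨G, hG, hGg⟩
    exact ⟨fun x => F x + G x, hF.add hG, fun x => by simp [hFf, hGg]⟩
  algebraMap_mem' := fun c =>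
    ⟨fun _ => c, differentiableOn_const c, fun x => by
      simp [BoundedContinuousFunction.algebraMap_apply]⟩

/-- The underlying subalgebra of `H_b(E)`: the entire functions on `E` that are bounded on
bounded sets. -/
def HbSubalgebra : Subalgebra ℂ (E → ℂ) where
  carrier := {f | Differentiable ℂ f ∧ ∀ s : Set E, IsBounded s → IsBounded (f '' s)}
  mul_mem' := by
    rintro f g ⟨hf, hfb⟩ ⟨hg, hgb⟩
    refine ⟨hf.mul hg, fun s hs => ?_⟩
    obtain ⟨C, hC⟩ := isBounded_iff_forall_norm_le.1 (hfb s hs)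
    obtain ⟨D, hD⟩ := isBounded_iff_forall_norm_le.1 (hgb s hs)
    refine isBounded_iff_forall_norm_le.2 ⟨C * D, ?_⟩
    rintro _ ⟨x, hx, rfl⟩
    have h1 := hC _ (mem_image_of_mem f hx)
    have h2 := hD _ (mem_image_of_mem g hx)
    simp only [Pi.mul_apply, norm_mul]
    exact mul_le_mul h1 h2 (norm_nonneg _) ((norm_nonneg _).trans h1)
  add_mem' := by
    rintro f g ⟨hf, hfb⟩ ⟨hg, hgb⟩
    refine ⟨hf.add hg, fun s hs => ?_⟩
    obtain ⟨C, hC⟩ := isBounded_iff_forall_norm_le.1 (hfb s hs)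
    obtain ⟨D, hD⟩ := isBounded_iff_forall_norm_le.1 (hgb s hs)
    refine isBounded_iff_forall_norm_le.2 ⟨C + D, ?_⟩
    rintro _ ⟨x, hx, rfl⟩
    exact (norm_add_le _ _).trans
      (add_le_add (hC _ (mem_image_of_mem f hx)) (hD _ (mem_image_of_mem g hx)))
  algebraMap_mem' := fun c => by
    refine ⟨differentiable_const c, fun s _ => ?_⟩
    refine isBounded_iff_forall_norm_le.2 ⟨‖c‖, ?_⟩
    rintro _ ⟨x, _, rfl⟩
    simp

/-- The algebra `H_b(E)` of holomorphic functions of bounded type on `E`. It is a separate type,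
so that it does not inherit the topology of pointwise convergence. -/
def Hb : Type _ := HbSubalgebra E

instance : CommRing (Hb E) := inferInstanceAs (CommRing (HbSubalgebra E))

instance : Algebra ℂ (Hb E) := inferInstanceAs (Algebra ℂ (HbSubalgebra E))

variable {E}

instance : CoeFun (Hb E) (fun _ => E → ℂ) := ⟨fun f => f.1⟩

theorem Hb.bddAbove (f : Hb E) {s : Set E} (hs : IsBounded s) :
    BddAbove ((fun x => ‖f x‖) '' s) := by
  obtain ⟨C, hC⟩ := isBounded_iff_forall_norm_le.1 (f.2.2 s hs)
  refine ⟨C, ?_⟩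
  rintro _ ⟨x, hx, rfl⟩
  exact hC _ (mem_image_of_mem _ hx)

theorem Hb.norm_le_supOn (f : Hb E) {s : Set E} (hs : IsBounded s) {x : E} (hx : x ∈ s) :
    ‖f x‖ ≤ supOn s f :=
  le_csSup (f.bddAbove hs) (mem_image_of_mem (fun x => ‖f x‖) hx)

theorem supOn_nonneg {α : Type*} (s : Set α) (f : α → ℂ) : 0 ≤ supOn s f := by
  apply Real.sSup_nonneg
  rintro _ ⟨x, _, rfl⟩
  exact norm_nonneg _

theorem supOn_le {α : Type*} {s : Set α} {f : α → ℂ} {C : ℝ} (hC : 0 ≤ C)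
    (h : ∀ x ∈ s, ‖f x‖ ≤ C) : supOn s f ≤ C := by
  apply Real.sSup_le _ hC
  rintro _ ⟨x, hx, rfl⟩
  exact h x hx

variable (E)

/-- The seminorms `f ↦ sup_{‖x‖ < R} |f x|`, `R > 0`, on `H_b(E)`. -/
def hbSeminorm : SeminormFamily ℂ (Hb E) (Ioi (0 : ℝ)) := fun R =>
  Seminorm.of (fun f => supOn (ball (0 : E) R) f)
    (fun f g => supOn_le (add_nonneg (supOn_nonneg _ _) (supOn_nonneg _ _)) fun _ hx =>
      (norm_add_le _ _).trans
        (add_le_add (f.norm_le_supOn isBounded_ball hx) (g.norm_le_supOn isBounded_ball hx)))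
    (fun a f => by
      have h : (fun x => ‖(a • f : Hb E) x‖) = fun x => ‖a‖ * ‖f x‖ := by
        funext x
        exact norm_mul a (f x)
      change sSup ((fun x => ‖(a • f : Hb E) x‖) '' _) = ‖a‖ * sSup ((fun x => ‖f x‖) '' _)
      rw [h, sSup_image', sSup_image', Real.mul_iSup_of_nonneg (norm_nonneg a)])

/-- The Fréchet topology of `H_b(E)`: uniform convergence on bounded sets, that is, the locally
convex topology generated by the seminorms `f ↦ sup_{‖x‖ < R} |f x|`, `R > 0`. -/
instance : TopologicalSpace (Hb E) := (hbSeminorm E).moduleFilterBasis.topology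

theorem Hb.withSeminorms : WithSeminorms (hbSeminorm E) := ⟨rfl⟩

/-- The restriction `f ↦ f|_{B_E}` from `H_b(E)` to `H^∞(B_E)`. -/
def restrictBall : Hb E →ₙₐ[ℂ] HInf E where
  toFun f := ⟨BoundedContinuousFunction.ofNormedAddCommGroup (fun x : ball (0 : E) 1 => f x)
      (f.2.1.continuous.comp continuous_subtype_val) (supOn (ball (0 : E) 1) f)
      (fun x => f.norm_le_supOn isBounded_ball x.2), f, f.2.1.differentiableOn, fun _ => rfl⟩
  map_smul' _ _ := rfl
  map_zero' := rfl
  map_add' _ _ := rfl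
  map_mul' _ _ := rfl

end Algebras

section Spectra

variable (X Y : Type*) [NormedAddCommGroup X] [NormedSpace ℂ X]
  [NormedAddCommGroup Y] [NormedSpace ℂ Y]

/-- The vector-valued spectrum `M_∞(B_X, B_Y)`: nonzero algebra homomorphisms (neither continuity
nor `Ψ 1 = 1` is part of the definition) from `H^∞(B_X)` to `H^∞(B_Y)`. -/
def MInf : Type _ := {Ψ : HInf X →ₙₐ[ℂ] HInf Y // Ψ ≠ 0}

/-- The vector-valued spectrum `M_{b,∞}(X, B_Y)`: nonzero continuous algebra homomorphisms from
`H_b(X)` to `H^∞(B_Y)`. -/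
def MbInf : Type _ := {Φ : Hb X →ₙₐ[ℂ] HInf Y // Continuous Φ ∧ Φ ≠ 0}

variable {X Y}

/-- The radius of `Φ ∈ M_{b,∞}(X, B_Y)`: the infimum of all `r > 0` such that
`‖Φ f‖ ≤ sup_{r B_X} |f|` for all `f ∈ H_b(X)`. -/
def MbInf.radius (Φ : MbInf X Y) : ℝ :=
  sInf {r : ℝ | 0 < r ∧ ∀ f : Hb X, ‖Φ.1 f‖ ≤ supOn (r • ball (0 : X) 1) f}

/-- The radius of `Ψ ∈ M_∞(B_X, B_Y)`: the smallest `r ∈ [0, 1]` such that `Ψ` is continuous with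
respect to uniform convergence on `r B_X` (which is `{0}` for `r = 0`). -/
def MInf.radius (Ψ : MInf X Y) : ℝ :=
  sInf {r : ℝ | 0 ≤ r ∧ r ≤ 1 ∧ ∃ C : ℝ, ∀ f : HInf X,
    ‖Ψ.1 f‖ ≤ C * supOn {x : ball (0 : X) 1 | (x : X) ∈ r • ball (0 : X) 1} f.1}

/-- Homomorphisms between the algebras `H^∞` are automatically contractive. -/
theorem norm_hom_apply_le (Ψ : HInf X →ₙₐ[ℂ] HInf Y) (f : HInf X) : ‖Ψ f‖ ≤ ‖f‖ := by
  refine (BoundedContinuousFunction.norm_le (norm_nonneg f)).2 fun y => ?_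
  by_contra! hlt
  let χ : HInf X → ℂ := fun g => (Ψ g).1 y
  change ‖f‖ < ‖χ f‖ at hlt
  have χmul : ∀ g h, χ (g * h) = χ g * χ h := fun g h => by simp [χ]
  have hχ0 : χ f ≠ 0 := norm_pos_iff.1 ((norm_nonneg f).trans_lt hlt)
  have hχ1 : χ 1 = 1 := by
    have h := χmul f 1
    rw [mul_one] at h
    exact mul_left_cancel₀ hχ0 (by rw [← h, mul_one])
  obtain ⟨F, hF, hFf⟩ := f.2
  have hbd : ∀ x : ball (0 : X) 1, ‖χ f‖ - ‖f‖ ≤ ‖χ f - F x‖ := fun x => by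
    have h1 : ‖F x‖ ≤ ‖f‖ := by rw [hFf]; exact f.1.norm_coe_le_norm x
    have h2 := norm_sub_norm_le (χ f) (F x)
    linarith
  have hne : ∀ x ∈ ball (0 : X) 1, χ f - F x ≠ 0 := fun x hx =>
    norm_pos_iff.1 ((sub_pos.2 hlt).trans_le (hbd ⟨x, hx⟩))
  have hG : DifferentiableOn ℂ (fun x => (χ f - F x)⁻¹) (ball 0 1) :=
    ((differentiableOn_const _).sub hF).inv hne
  let g : HInf X := ⟨BoundedContinuousFunction.ofNormedAddCommGroup
      (fun x : ball (0 : X) 1 => (χ f - F x)⁻¹)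
      (continuousOn_iff_continuous_domRestrict.1 hG.continuousOn) (‖χ f‖ - ‖f‖)⁻¹
      (fun x => by
        rw [norm_inv]
        exact inv_anti₀ (sub_pos.2 hlt) (hbd x)), _, hG, fun _ => rfl⟩
  have hfg : (χ f • (1 : HInf X) - f) * g = 1 := by
    refine Subtype.ext (BoundedContinuousFunction.ext fun x => ?_)
    change (χ f * 1 - f.1 x) * (χ f - F x)⁻¹ = 1
    rw [mul_one, ← hFf]
    exact mul_inv_cancel₀ (hne x x.2)
  have h0 : χ (χ f • (1 : HInf X) - f) = 0 := by
    have : χ (χ f • (1 : HInf X) - f) = χ f * χ 1 - χ f := by simp [χ]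
    rw [this, hχ1, mul_one, sub_self]
  have := χmul (χ f • (1 : HInf X) - f) g
  rw [hfg, h0, zero_mul, hχ1] at this
  exact one_ne_zero this

/-- The restriction of a homomorphism on `H^∞(B_X)` to `H_b(X)` is continuous. -/
theorem continuous_comp_restrictBall (Ψ : HInf X →ₙₐ[ℂ] HInf Y) :
    Continuous (Ψ.comp (restrictBall X)) := by
  let L : Hb X →ₗ[ℂ] HInf Y :=
    { toFun := fun f => Ψ (restrictBall X f)
      map_add' := fun f g => by rw [map_add, map_add]
      map_smul' := fun c f => by rw [map_smul, map_smul, RingHom.id_apply] }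
  have hL : (normSeminorm ℂ (HInf Y)).comp L ≤
      (1 : NNReal) • ({⟨1, mem_Ioi.2 one_pos⟩} : Finset (Ioi (0 : ℝ))).sup (hbSeminorm X) := by
    rw [one_smul, Finset.sup_singleton]
    intro f
    have h : ‖restrictBall X f‖ ≤ supOn (ball (0 : X) 1) f :=
      (BoundedContinuousFunction.norm_le (supOn_nonneg _ _)).2
        fun x => f.norm_le_supOn isBounded_ball x.2
    exact (norm_hom_apply_le Ψ (restrictBall X f)).trans h
  exact WithSeminorms.continuous_normedSpace_rng (HInf Y) (Hb.withSeminorms X) L ⟨_, _, hL⟩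

/-- The restriction of a nonzero homomorphism on `H^∞(B_X)` to `H_b(X)` is nonzero. -/
theorem comp_restrictBall_ne_zero {Ψ : HInf X →ₙₐ[ℂ] HInf Y} (hΨ : Ψ ≠ 0) :
    Ψ.comp (restrictBall X) ≠ 0 := by
  intro h
  refine hΨ (NonUnitalAlgHom.ext fun f => ?_)
  have h1 : Ψ 1 = 0 := DFunLike.congr_fun h (1 : Hb X)
  rw [← mul_one f, map_mul, h1, mul_zero]
  rfl

/-- The projection `ϱ : M_∞(B_X, B_Y) → M_{b,∞}(X, B_Y)`, `ϱ(Ψ)(f) = Ψ(f|_{B_X})`. -/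
def rho (Ψ : MInf X Y) : MbInf X Y :=
  ⟨Ψ.1.comp (restrictBall X), continuous_comp_restrictBall Ψ.1, comp_restrictBall_ne_zero Ψ.2⟩

end Spectra

end VectorSpectrum

end

/-! Every homomorphism on `H^∞(B_X)` is contractive (`norm_hom_apply_le`), so a restriction has
radius at most 1. The converse needs an extension of Φ from `H_b(X)` to `H^∞(B_X)`. The Taylor
polynomials P_n of f ∈ `H^∞(B_X)` at 0 lie in `H_b(X)`, and if R(Φ) ≤ 1 then Cauchy's estimates give
|Φ(P_n)(y)| ≤ ‖f‖. The series ∑ Φ(P_n)(y) may diverge when R(Φ) = 1, but its Abel means ∑ Φ(P_n)(y)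
sⁿ, 0 < s < 1, converge absolutely. They are multiplicative in f by the Cauchy product, hence
bounded by ‖f‖ (`MbInf.norm_abelMean_le`). Their limit along one fixed ultrafilter s → 1⁻ is again
multiplicative, and it is holomorphic in y because bounded pointwise limits of holomorphic functions
are holomorphic (`differentiableOn_of_tendsto_of_norm_le`). For f from `H_b(X)` the series itself
converges to Φ(f)(y), so Abel's theorem shows that Φ has been extended
(`MbInf.extension_restrictBall`).

Below radius 1, geometric domination makes the extension continuous for a smaller ball
(`MbInf.norm_extension_le`). Conversely, such continuity lets Ψ be applied termwise to the Taylor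
series, which converges uniformly on smaller balls; so Ψ is determined by its restriction
(`MInf.tendsto_sum_rho_taylor`). -/

section

open Metric Set Topology Bornology Filter
open scoped Pointwise BoundedContinuousFunction

namespace VectorSpectrum

/-! ### Homogeneous Taylor expansion along complex lines -/

section Taylor

variable {E : Type*} [NormedAddCommGroup E] [NormedSpace ℂ E]

/-- The `n`-th homogeneous Taylor polynomial at `0` of a function `f` on `E`, defined along
complex lines. -/
noncomputable def taylorCoeff (f : E → ℂ) (n : ℕ) (x : E) : ℂ :=
  (n.factorial : ℂ)⁻¹ * iteratedDeriv n (fun ζ : ℂ => f (ζ • x)) 0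

theorem differentiableOn_line {f : E → ℂ} {δ R : ℝ} (hf : DifferentiableOn ℂ f (ball 0 δ)) {x : E}
    (hR : R * ‖x‖ ≤ δ) (hx : x ≠ 0) : DifferentiableOn ℂ (fun ζ : ℂ => f (ζ • x)) (ball 0 R) := by
  refine hf.comp (by fun_prop) fun ζ hζ => ?_
  rw [mem_ball_zero_iff] at hζ ⊢
  rw [norm_smul]
  exact (mul_lt_mul_of_pos_right hζ (norm_pos_iff.2 hx)).trans_le hR

theorem contDiffAt_line {f : E → ℂ} {δ : ℝ} (hδ : 0 < δ) (hf : DifferentiableOn ℂ f (ball 0 δ))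
    (x : E) {n : WithTop ℕ∞} : ContDiffAt ℂ n (fun ζ : ℂ => f (ζ • x)) 0 := by
  rcases eq_or_ne x 0 with rfl | hx
  · simpa using contDiffAt_const
  have hx' := norm_pos_iff.2 hx
  have h := differentiableOn_line (R := δ / ‖x‖) hf (by field_simp; rfl) hx
  exact (h.contDiffOn isOpen_ball).contDiffAt (ball_mem_nhds _ (by positivity))

theorem taylorCoeff_zero (f : E → ℂ) (x : E) : taylorCoeff f 0 x = f 0 := by
  simp [taylorCoeff]

theorem taylorCoeff_one {f : E → ℂ} {x : E} {f' : E →L[ℂ] ℂ} (hf : HasFDerivAt f f' 0) :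
    taylorCoeff f 1 x = f' x := by
  have h1 : HasDerivAt (fun ζ : ℂ => ζ • x) x 0 := by
    simpa using (hasDerivAt_id (0 : ℂ)).smul_const x
  have h2 : HasFDerivAt f f' ((0 : ℂ) • x) := by simpa using hf
  simpa [taylorCoeff, iteratedDeriv_one, Function.comp_def] using
    (h2.comp_hasDerivAt (0 : ℂ) h1).deriv

/-- Cauchy's estimate on the circle of radius R in the line through x, for R‖x‖ < δ, followed by R →
δ/‖x‖. -/
theorem norm_taylorCoeff_le {f : E → ℂ} {δ M : ℝ} (hδ : 0 < δ)
    (hf : DifferentiableOn ℂ f (ball 0 δ)) (hM : ∀ x ∈ ball (0 : E) δ, ‖f x‖ ≤ M) (n : ℕ) (x : E) :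
    ‖taylorCoeff f n x‖ ≤ M * (‖x‖ / δ) ^ n := by
  have hM0 : 0 ≤ M := (norm_nonneg _).trans (hM 0 (mem_ball_self hδ))
  have key : ∀ R : ℝ, 0 < R → R * ‖x‖ < δ → ‖taylorCoeff f n x‖ ≤ M / R ^ n := by
    intro R hR hRx
    have hsub : ∀ ζ ∈ closedBall (0 : ℂ) R, ζ • x ∈ ball (0 : E) δ := fun ζ hζ => by
      rw [mem_closedBall_zero_iff] at hζ
      rw [mem_ball_zero_iff, norm_smul]
      exact (mul_le_mul_of_nonneg_right hζ (norm_nonneg _)).trans_lt hRx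
    have hd : DifferentiableOn ℂ (fun ζ : ℂ => f (ζ • x)) (closedBall 0 R) :=
      hf.comp (by fun_prop) hsub
    have h := Complex.norm_iteratedDeriv_le_of_forall_mem_sphere_norm_le (C := M) n hR
      (DifferentiableOn.diffContOnCl (by rwa [closure_ball _ hR.ne']))
      fun z hz => hM _ (hsub z (sphere_subset_closedBall hz))
    rw [taylorCoeff, norm_mul, norm_inv, Complex.norm_natCast]
    have hn : (0 : ℝ) < n.factorial := by exact_mod_cast n.factorial_pos
    rw [inv_mul_le_iff₀ hn]
    exact h.trans_eq (by ring)
  -- Taking R = δ/(‖x‖ + ε) keeps R‖x‖ < δ and also covers x = 0.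
  have hlim : Tendsto (fun ε : ℝ => M * ((‖x‖ + ε) / δ) ^ n) (𝓝[>] 0)
      (𝓝 (M * ((‖x‖ + 0) / δ) ^ n)) :=
    (Continuous.tendsto (by fun_prop) 0).mono_left nhdsWithin_le_nhds
  rw [add_zero] at hlim
  refine ge_of_tendsto hlim (eventually_nhdsWithin_of_forall fun ε (hε : 0 < ε) => ?_)
  have hx := norm_nonneg x
  have hpos : 0 < ‖x‖ + ε := by linarith
  refine (key (δ / (‖x‖ + ε)) (by positivity) ?_).trans_eq ?_
  · rw [div_mul_eq_mul_div, div_lt_iff₀ hpos]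
    nlinarith
  · rw [div_pow, div_pow]
    field_simp

theorem hasSum_taylorCoeff_smul {f : E → ℂ} {δ : ℝ} (hf : DifferentiableOn ℂ f (ball 0 δ))
    {x : E} {t : ℂ} (hx : ‖t‖ * ‖x‖ < δ) :
    HasSum (fun n => t ^ n * taylorCoeff f n x) (f (t • x)) := by
  have hδ : 0 < δ := by
    have := norm_nonneg x
    have := norm_nonneg t
    nlinarith [mul_nonneg ‹0 ≤ ‖x‖› ‹0 ≤ ‖t‖›]
  rcases eq_or_ne x 0 with rfl | hx0
  · have h : ∀ n ≠ 0, t ^ n * taylorCoeff f n (0 : E) = 0 := fun n hn => by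
      simp [taylorCoeff, iteratedDeriv_const, hn]
    have := hasSum_single 0 h
    simpa [taylorCoeff_zero] using this
  have hx' := norm_pos_iff.2 hx0
  have hd := differentiableOn_line (R := δ / ‖x‖) hf (by field_simp; rfl) hx0
  have ht : t ∈ ball (0 : ℂ) (δ / ‖x‖) := by
    rw [mem_ball_zero_iff, lt_div_iff₀ hx']
    exact hx
  have heq : (fun n => t ^ n * taylorCoeff f n x) = fun n : ℕ => (n.factorial : ℂ)⁻¹ •
      (t - 0) ^ n • iteratedDeriv n (fun ζ : ℂ => f (ζ • x)) 0 := by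
    funext n
    simp only [taylorCoeff, smul_eq_mul, sub_zero]
    ring
  rw [heq]
  exact Complex.hasSum_taylorSeries_on_ball hd ht

/-- Tail of a geometric series. The scalar t is kept apart from x so that the remainder can later be
divided by tⁿ. -/
theorem norm_sub_sum_taylorCoeff_smul_le {f : E → ℂ} {δ M : ℝ}
    (hf : DifferentiableOn ℂ f (ball 0 δ)) (hM : ∀ x ∈ ball (0 : E) δ, ‖f x‖ ≤ M)
    {x : E} {t : ℂ} (hx : ‖t‖ * ‖x‖ < δ) (n : ℕ) :
    ‖f (t • x) - ∑ k ∈ Finset.range n, t ^ k * taylorCoeff f k x‖ ≤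
      M * (‖t‖ * ‖x‖ / δ) ^ n / (1 - ‖t‖ * ‖x‖ / δ) := by
  have hδ : 0 < δ := (by positivity : 0 ≤ ‖t‖ * ‖x‖).trans_lt hx
  rw [norm_sub_rev]
  refine norm_sub_le_of_geometric_bound_of_hasSum ((div_lt_one hδ).2 hx) (fun k => ?_)
    (hasSum_taylorCoeff_smul hf hx) n
  rw [norm_mul, norm_pow, mul_div_assoc, mul_pow, mul_left_comm]
  exact mul_le_mul_of_nonneg_left (norm_taylorCoeff_le hδ hf hM k x) (by positivity)

theorem norm_sub_sum_taylorCoeff_le {f : E → ℂ} {δ M : ℝ}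
    (hf : DifferentiableOn ℂ f (ball 0 δ)) (hM : ∀ x ∈ ball (0 : E) δ, ‖f x‖ ≤ M)
    {x : E} (hx : x ∈ ball (0 : E) δ) (n : ℕ) :
    ‖f x - ∑ k ∈ Finset.range n, taylorCoeff f k x‖ ≤
      M * (‖x‖ / δ) ^ n / (1 - ‖x‖ / δ) := by
  simpa using norm_sub_sum_taylorCoeff_smul_le (t := 1) hf hM (by simpa using hx) n

theorem taylorCoeff_congr {f g : E → ℂ} {δ : ℝ} (hδ : 0 < δ) (h : ∀ x ∈ ball (0 : E) δ, f x = g x)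
    (n : ℕ) : taylorCoeff f n = taylorCoeff g n := by
  funext x
  have : (fun ζ : ℂ => f (ζ • x)) =ᶠ[𝓝 0] fun ζ : ℂ => g (ζ • x) := by
    have hc : Tendsto (fun ζ : ℂ => ζ • x) (𝓝 0) (𝓝 0) :=
      (Continuous.tendsto' (by fun_prop) _ _ (zero_smul ℂ x))
    filter_upwards [hc (ball_mem_nhds 0 hδ)] with ζ hζ using h _ hζ
  rw [taylorCoeff, taylorCoeff, this.iteratedDeriv_eq]

theorem taylorCoeff_add {f g : E → ℂ} {δ : ℝ} (hδ : 0 < δ) (hf : DifferentiableOn ℂ f (ball 0 δ))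
    (hg : DifferentiableOn ℂ g (ball 0 δ)) (n : ℕ) :
    taylorCoeff (f + g) n = taylorCoeff f n + taylorCoeff g n := by
  funext x
  simp only [taylorCoeff, Pi.add_apply]
  rw [iteratedDeriv_fun_add (contDiffAt_line hδ hf x) (contDiffAt_line hδ hg x), mul_add]

theorem taylorCoeff_smul (c : ℂ) (f : E → ℂ) (n : ℕ) :
    taylorCoeff (c • f) n = c • taylorCoeff f n := by
  funext x
  simp only [taylorCoeff, Pi.smul_apply, smul_eq_mul, iteratedDeriv_const_mul_field]
  ring

/-- Leibniz' rule. This convolution is what makes the Abel means multiplicative. -/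
theorem taylorCoeff_mul {f g : E → ℂ} {δ : ℝ} (hδ : 0 < δ) (hf : DifferentiableOn ℂ f (ball 0 δ))
    (hg : DifferentiableOn ℂ g (ball 0 δ)) (n : ℕ) :
    taylorCoeff (f * g) n =
      ∑ p ∈ Finset.HasAntidiagonal.antidiagonal n, taylorCoeff f p.1 * taylorCoeff g p.2 := by
  funext x
  simp only [taylorCoeff, Pi.mul_apply, Finset.sum_apply]
  rw [iteratedDeriv_fun_mul (contDiffAt_line hδ hf x) (contDiffAt_line hδ hg x),
    Finset.Nat.sum_antidiagonal_eq_sum_range_succ_mk, Finset.mul_sum]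
  refine Finset.sum_congr rfl fun k hk => ?_
  have hk' : k ≤ n := Nat.lt_succ_iff.1 (Finset.mem_range.1 hk)
  rw [Nat.cast_choose ℂ hk']
  have h1 : (n.factorial : ℂ) ≠ 0 := by exact_mod_cast n.factorial_ne_zero
  have h2 : (k.factorial : ℂ) ≠ 0 := by exact_mod_cast k.factorial_ne_zero
  have h3 : ((n - k).factorial : ℂ) ≠ 0 := by exact_mod_cast (n - k).factorial_ne_zero
  field_simp

end Taylor

/-! ### Holomorphy of bounded pointwise limits and of Taylor polynomials -/

section Limits

variable {E : Type*} [NormedAddCommGroup E] [NormedSpace ℂ E]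

/-- Both bounds depend on f only through M and δ, so they are uniform over a bounded family and
survive a pointwise limit. -/
theorem norm_fderiv_le_of_norm_le {f : E → ℂ} {δ M : ℝ} (hδ : 0 < δ) {a : E}
    (hf : DifferentiableOn ℂ f (ball a δ)) (hM : ∀ x ∈ ball a δ, ‖f x‖ ≤ M) :
    ‖fderiv ℂ f a‖ ≤ M / δ ∧ ∀ v ∈ ball (0 : E) δ,
      ‖f (a + v) - f a - fderiv ℂ f a v‖ ≤ M * (‖v‖ / δ) ^ 2 / (1 - ‖v‖ / δ) := by
  have hmaps : ∀ v ∈ ball (0 : E) δ, a + v ∈ ball a δ := fun v hv => by simpa using hv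
  have hd : DifferentiableOn ℂ (fun v => f (a + v)) (ball 0 δ) := hf.comp (by fun_prop) hmaps
  have hb : ∀ v ∈ ball (0 : E) δ, ‖f (a + v)‖ ≤ M := fun v hv => hM _ (hmaps v hv)
  have hfd : HasFDerivAt (fun v => f (a + v)) (fderiv ℂ f a) 0 := by
    have h1 : HasFDerivAt f (fderiv ℂ f a) (a + 0) := by
      rw [add_zero]
      exact (hf.differentiableAt (ball_mem_nhds a hδ)).hasFDerivAt
    simpa using (hasFDerivAt_comp_add_left a).2 h1
  have hM0 : 0 ≤ M := (norm_nonneg _).trans (hM a (mem_ball_self hδ))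
  refine ⟨ContinuousLinearMap.opNorm_le_bound _ (by positivity) fun v => ?_, fun v hv => ?_⟩
  · rw [← taylorCoeff_one hfd]
    exact (norm_taylorCoeff_le hδ hd hb 1 v).trans_eq (by ring)
  · have h := norm_sub_sum_taylorCoeff_le hd hb hv 2
    rw [Finset.sum_range_succ, Finset.sum_range_one, taylorCoeff_zero, taylorCoeff_one hfd,
      add_zero, ← sub_sub] at h
    exact h

/-- A pointwise limit of uniformly bounded holomorphic functions is holomorphic. -/
theorem differentiableOn_of_tendsto_of_norm_le {ι : Type*} {l : Filter ι} [l.NeBot]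
    {F : ι → E → ℂ} {G : E → ℂ} {U : Set E} {M : ℝ} (hU : IsOpen U)
    (hF : ∀ᶠ i in l, DifferentiableOn ℂ (F i) U ∧ ∀ x ∈ U, ‖F i x‖ ≤ M)
    (hG : ∀ x ∈ U, Tendsto (fun i => F i x) l (𝓝 (G x))) : DifferentiableOn ℂ G U := by
  intro a ha
  obtain ⟨δ, hδ, hball⟩ := Metric.isOpen_iff.1 hU a ha
  -- The derivatives at a stay in a fixed dual ball, so by Banach–Alaoglu they converge weak-* along
  -- an ultrafilter finer than l.
  let u : Ultrafilter ι := Ultrafilter.of l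
  have hul : (u : Filter ι) ≤ l := Ultrafilter.of_le l
  have hest : ∀ᶠ i in (u : Filter ι), ‖fderiv ℂ (F i) a‖ ≤ M / δ ∧ ∀ v ∈ ball (0 : E) δ,
      ‖F i (a + v) - F i a - fderiv ℂ (F i) a v‖ ≤ M * (‖v‖ / δ) ^ 2 / (1 - ‖v‖ / δ) := by
    filter_upwards [hul hF] with i hi
    exact norm_fderiv_le_of_norm_le hδ (hi.1.mono hball) fun x hx => hi.2 x (hball hx)
  let D : ι → WeakDual ℂ E := fun i => StrongDual.toWeakDual (fderiv ℂ (F i) a)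
  have hK := WeakDual.isCompact_closedBall (0 : StrongDual ℂ E) (M / δ)
  obtain ⟨L, -, hL⟩ := hK.ultrafilter_le_nhds (u.map D) (by
      rw [le_principal_iff]
      change ∀ᶠ i in (u : Filter ι), D i ∈ _
      filter_upwards [hest] with i hi
      simpa [D] using hi.1)
  have hLv : ∀ v, Tendsto (fun i => fderiv ℂ (F i) a v) u (𝓝 (L v)) := fun v =>
    ((WeakDual.eval_continuous v).tendsto L).comp (show Tendsto D u (𝓝 L) from hL)
  -- The quadratic remainder bound passes to the limit and identifies L as the derivative of G at a.
  have hrem : ∀ v ∈ ball (0 : E) δ,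
      ‖G (a + v) - G a - L v‖ ≤ M * (‖v‖ / δ) ^ 2 / (1 - ‖v‖ / δ) := fun v hv =>
    le_of_tendsto ((((hG _ (hball (by simpa using hv))).mono_left hul).sub
      ((hG a ha).mono_left hul)).sub (hLv v)).norm (hest.mono fun i hi => hi.2 v hv)
  have hfd : HasFDerivAt G (WeakDual.toStrongDual L) a := by
    rw [hasFDerivAt_iff_isLittleO_nhds_zero]
    have hO : (fun v => G (a + v) - G a - L v) =O[𝓝 0] fun v : E => ‖v‖ ^ 2 := by
      refine Asymptotics.IsBigO.of_bound (2 * |M| / δ ^ 2) ?_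
      filter_upwards [ball_mem_nhds (0 : E) (half_pos hδ)] with v hv
      rw [mem_ball_zero_iff] at hv
      have hq : ‖v‖ / δ ≤ 1 / 2 := by
        rw [div_le_iff₀ hδ]
        linarith
      refine (hrem v (by rw [mem_ball_zero_iff]; linarith)).trans ?_
      rw [div_le_iff₀ (by linarith), Real.norm_of_nonneg (by positivity)]
      calc M * (‖v‖ / δ) ^ 2 ≤ |M| * (‖v‖ / δ) ^ 2 :=
            mul_le_mul_of_nonneg_right (le_abs_self M) (by positivity)
        _ = 2 * |M| / δ ^ 2 * ‖v‖ ^ 2 * (1 / 2) := by field_simp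
        _ ≤ _ := mul_le_mul_of_nonneg_left (by linarith) (by positivity)
    refine hO.trans_isLittleO ?_
    simpa using Asymptotics.isLittleO_norm_pow_id (E' := E) one_lt_two
  exact hfd.differentiableAt.differentiableWithinAt

/-- By strong induction: on each ball of radius R, the n-th coefficient is the limit as t → 0 of
t⁻ⁿ(f(tx) − ∑_{k<n} tᵏP_k(x)), a family bounded by 2M(R/δ)ⁿ for small t. -/
theorem differentiable_taylorCoeff {f : E → ℂ} {δ M : ℝ} (hδ : 0 < δ)
    (hf : DifferentiableOn ℂ f (ball 0 δ)) (hM : ∀ x ∈ ball (0 : E) δ, ‖f x‖ ≤ M) (n : ℕ) :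
    Differentiable ℂ (taylorCoeff f n) := by
  induction n using Nat.strong_induction_on with
  | _ n ih =>
  have hM0 : 0 ≤ M := (norm_nonneg _).trans (hM 0 (mem_ball_self hδ))
  have hball : ∀ R > 0, DifferentiableOn ℂ (taylorCoeff f n) (ball 0 R) := by
    intro R hR
    -- The ratio of the geometric tail is then at most 1/2, which accounts for the factor 2 in the
    -- bounds.
    have hsmall : ∀ᶠ t : ℂ in 𝓝[≠] 0, t ≠ 0 ∧ ‖t‖ * R < δ / 2 := by
      refine (eventually_mem_nhdsWithin (s := {0}ᶜ)).and (nhdsWithin_le_nhds ?_)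
      have : Tendsto (fun t : ℂ => ‖t‖ * R) (𝓝 0) (𝓝 0) :=
        Continuous.tendsto' (by fun_prop) _ _ (by simp)
      exact this.eventually_lt_const (half_pos hδ)
    refine differentiableOn_of_tendsto_of_norm_le (l := 𝓝[≠] (0 : ℂ)) (M := 2 * M * (R / δ) ^ n)
      (F := fun t x => (t ^ n)⁻¹ * (f (t • x) - ∑ k ∈ Finset.range n, t ^ k * taylorCoeff f k x))
      isOpen_ball ?_ fun x hx => ?_
    · filter_upwards [hsmall] with t ht
      have hmaps : ∀ x ∈ ball (0 : E) R, ‖t‖ * ‖x‖ < δ / 2 := fun x hx =>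
        (mul_le_mul_of_nonneg_left (mem_ball_zero_iff.1 hx).le (norm_nonneg t)).trans_lt ht.2
      refine ⟨.const_mul (.sub (hf.comp (by fun_prop) fun x hx => ?_) (.fun_sum fun k hk =>
        .const_mul (ih k (Finset.mem_range.1 hk)).differentiableOn _)) _, fun x hx => ?_⟩
      · rw [mem_ball_zero_iff, norm_smul]
        linarith [hmaps x hx]
      · have h := norm_sub_sum_taylorCoeff_smul_le hf hM (t := t) (x := x)
          (by linarith [hmaps x hx]) n
        have hq : ‖t‖ * ‖x‖ / δ ≤ 1 / 2 := by
          rw [div_le_iff₀ hδ]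
          linarith [hmaps x hx]
        have htn : 0 < ‖t‖ ^ n := pow_pos (norm_pos_iff.2 ht.1) n
        rw [norm_mul, norm_inv, norm_pow, inv_mul_le_iff₀ htn]
        refine h.trans ?_
        rw [div_le_iff₀ (by linarith)]
        have hxR : ‖x‖ ^ n ≤ R ^ n :=
          pow_le_pow_left₀ (norm_nonneg x) (mem_ball_zero_iff.1 hx).le n
        calc M * (‖t‖ * ‖x‖ / δ) ^ n = M * ‖t‖ ^ n / δ ^ n * ‖x‖ ^ n := by
              rw [div_pow, mul_pow]; ring
          _ ≤ M * ‖t‖ ^ n / δ ^ n * R ^ n := by gcongr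
          _ = ‖t‖ ^ n * (2 * M * (R / δ) ^ n) * (1 / 2) := by rw [div_pow]; ring
          _ ≤ _ := mul_le_mul_of_nonneg_left (by linarith) (by positivity)
    · rw [tendsto_iff_norm_sub_tendsto_zero]
      have hlim : Tendsto (fun t : ℂ => 2 * M * (R / δ) ^ (n + 1) * ‖t‖) (𝓝[≠] 0) (𝓝 0) :=
        (Continuous.tendsto' (by fun_prop) _ _ (by simp)).mono_left nhdsWithin_le_nhds
      refine squeeze_zero' (.of_forall fun t => norm_nonneg _) ?_ hlim
      filter_upwards [hsmall] with t ht
      have htx : ‖t‖ * ‖x‖ < δ / 2 :=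
        (mul_le_mul_of_nonneg_left (mem_ball_zero_iff.1 hx).le (norm_nonneg t)).trans_lt ht.2
      have h := norm_sub_sum_taylorCoeff_smul_le hf hM (t := t) (x := x) (by linarith) (n + 1)
      have hq : ‖t‖ * ‖x‖ / δ ≤ 1 / 2 := by
        rw [div_le_iff₀ hδ]
        linarith
      have htn : 0 < ‖t‖ ^ n := pow_pos (norm_pos_iff.2 ht.1) n
      have heq : (t ^ n)⁻¹ * (f (t • x) - ∑ k ∈ Finset.range n, t ^ k * taylorCoeff f k x) -
          taylorCoeff f n x = (t ^ n)⁻¹ *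
            (f (t • x) - ∑ k ∈ Finset.range (n + 1), t ^ k * taylorCoeff f k x) := by
        rw [Finset.sum_range_succ]
        have := pow_ne_zero n ht.1
        field_simp
        ring
      rw [heq, norm_mul, norm_inv, norm_pow, inv_mul_le_iff₀ htn]
      refine h.trans ?_
      rw [div_le_iff₀ (by linarith)]
      have hxR : ‖x‖ ^ (n + 1) ≤ R ^ (n + 1) :=
        pow_le_pow_left₀ (norm_nonneg x) (mem_ball_zero_iff.1 hx).le _
      calc M * (‖t‖ * ‖x‖ / δ) ^ (n + 1) = M * ‖t‖ ^ (n + 1) / δ ^ (n + 1) * ‖x‖ ^ (n + 1) := by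
            rw [div_pow, mul_pow]; ring
        _ ≤ M * ‖t‖ ^ (n + 1) / δ ^ (n + 1) * R ^ (n + 1) := by gcongr
        _ = ‖t‖ ^ n * (2 * M * (R / δ) ^ (n + 1) * ‖t‖) * (1 / 2) := by rw [div_pow]; ring
        _ ≤ _ := mul_le_mul_of_nonneg_left (by linarith) (by positivity)
  intro x
  exact (hball (‖x‖ + 1) (by positivity)).differentiableAt
    (isOpen_ball.mem_nhds (by simp))

end Limits

/-! ### Functions in `H^∞` and their Taylor polynomials in `H_b` -/

section HInfAPI

variable {E : Type*} [NormedAddCommGroup E] [NormedSpace ℂ E]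

open Classical in
/-- The extension by zero of a function in `H^∞(B_E)`. -/
noncomputable def HInf.extend (f : HInf E) (x : E) : ℂ :=
  if hx : x ∈ ball (0 : E) 1 then f.1 ⟨x, hx⟩ else 0

theorem HInf.extend_of_mem (f : HInf E) {x : E} (hx : x ∈ ball (0 : E) 1) :
    HInf.extend f x = f.1 ⟨x, hx⟩ := dif_pos hx

theorem HInf.extend_coe (f : HInf E) (x : ball (0 : E) 1) : HInf.extend f x = f.1 x := dif_pos x.2

theorem HInf.differentiableOn_extend (f : HInf E) :
    DifferentiableOn ℂ (HInf.extend f) (ball 0 1) := by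
  obtain ⟨F, hF, hFf⟩ := f.2
  exact hF.congr fun x hx => by rw [HInf.extend_of_mem f hx, ← hFf]

theorem HInf.norm_extend_le (f : HInf E) (x : E) : ‖HInf.extend f x‖ ≤ ‖f‖ := by
  by_cases hx : x ∈ ball (0 : E) 1
  · rw [HInf.extend_of_mem f hx]
    exact f.1.norm_coe_le_norm _
  · rw [HInf.extend, dif_neg hx, norm_zero]
    exact norm_nonneg f

theorem HInf.extend_add (f g : HInf E) : HInf.extend (f + g) = HInf.extend f + HInf.extend g := by
  funext x
  by_cases hx : x ∈ ball (0 : E) 1 <;> simp [HInf.extend, hx]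

theorem HInf.extend_mul (f g : HInf E) : HInf.extend (f * g) = HInf.extend f * HInf.extend g := by
  funext x
  by_cases hx : x ∈ ball (0 : E) 1 <;> simp [HInf.extend, hx]

theorem HInf.extend_smul (c : ℂ) (f : HInf E) : HInf.extend (c • f) = c • HInf.extend f := by
  funext x
  by_cases hx : x ∈ ball (0 : E) 1 <;> simp [HInf.extend, hx]

theorem HInf.extend_sub (f g : HInf E) : HInf.extend (f - g) = HInf.extend f - HInf.extend g := by
  funext x
  by_cases hx : x ∈ ball (0 : E) 1 <;> simp [HInf.extend, hx]

theorem HInf.extend_sum {ι : Type*} (s : Finset ι) (f : ι → HInf E) :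
    HInf.extend (∑ i ∈ s, f i) = ∑ i ∈ s, HInf.extend (f i) :=
  map_sum (AddMonoidHom.mk' HInf.extend HInf.extend_add) f s

theorem HInf.ext_of_extend {f g : HInf E}
    (h : ∀ x ∈ ball (0 : E) 1, HInf.extend f x = HInf.extend g x) :
    f = g :=
  Subtype.ext (BoundedContinuousFunction.ext fun x => by
    rw [← HInf.extend_coe f, ← HInf.extend_coe g, h x x.2])

theorem HInf.norm_le_of_extend {f : HInf E} {C : ℝ} (hC : 0 ≤ C)
    (h : ∀ x ∈ ball (0 : E) 1, ‖HInf.extend f x‖ ≤ C) : ‖f‖ ≤ C :=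
  (BoundedContinuousFunction.norm_le hC).2 fun x => by
    change ‖f.1 x‖ ≤ C
    rw [← HInf.extend_coe f]
    exact h x x.2

/-- The element of `H^∞(B_E)` given by a function that is holomorphic and bounded on `B_E`. -/
noncomputable def HInf.ofBound (F : E → ℂ) (M : ℝ) (hF : DifferentiableOn ℂ F (ball 0 1))
    (hM : ∀ x, ‖F x‖ ≤ M) : HInf E :=
  ⟨BoundedContinuousFunction.ofNormedAddCommGroup (fun x : ball (0 : E) 1 => F x)
    (continuousOn_iff_continuous_domRestrict.1 hF.continuousOn) M fun x => hM x,
    F, hF, fun _ => rfl⟩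

theorem HInf.extend_ofBound {F : E → ℂ} {M : ℝ} {hF : DifferentiableOn ℂ F (ball 0 1)}
    {hM : ∀ x, ‖F x‖ ≤ M} {x : E} (hx : x ∈ ball (0 : E) 1) :
    HInf.extend (HInf.ofBound F M hF hM) x = F x := HInf.extend_of_mem _ hx

/-- The `n`-th Taylor polynomial of a function in `H^∞(B_E)`, as an element of `H_b(E)`. -/
noncomputable def HInf.taylor (f : HInf E) (n : ℕ) : Hb E :=
  ⟨taylorCoeff (HInf.extend f) n,
    differentiable_taylorCoeff one_pos (HInf.differentiableOn_extend f)
      (fun x _ => HInf.norm_extend_le f x) n,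
    fun s hs => by
      obtain ⟨R, hR⟩ := isBounded_iff_forall_norm_le.1 hs
      refine isBounded_iff_forall_norm_le.2 ⟨‖f‖ * (R / 1) ^ n, ?_⟩
      rintro _ ⟨x, hx, rfl⟩
      refine (norm_taylorCoeff_le one_pos (HInf.differentiableOn_extend f)
        (fun x _ => HInf.norm_extend_le f x) n x).trans ?_
      have := hR x hx
      have := norm_nonneg f
      gcongr⟩

theorem HInf.taylor_apply (f : HInf E) (n : ℕ) (x : E) :
    HInf.taylor f n x = taylorCoeff (HInf.extend f) n x := rfl

theorem Hb.ext {f g : Hb E} (h : ∀ x, f x = g x) : f = g := Subtype.ext (funext h)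

theorem Hb.sum_apply {ι : Type*} (s : Finset ι) (f : ι → Hb E) (x : E) :
    (∑ i ∈ s, f i : Hb E) x = ∑ i ∈ s, f i x :=
  map_sum (AddMonoidHom.mk' (fun f : Hb E => f x) fun _ _ => rfl) f s

theorem Hb.sub_apply (f g : Hb E) (x : E) : (f - g : Hb E) x = f x - g x := rfl

theorem HInf.taylor_add (f g : HInf E) (n : ℕ) :
    HInf.taylor (f + g) n = HInf.taylor f n + HInf.taylor g n :=
  Hb.ext fun x => by
    rw [taylor_apply, extend_add, taylorCoeff_add one_pos (HInf.differentiableOn_extend f)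
      (HInf.differentiableOn_extend g)]
    rfl

theorem HInf.taylor_smul (c : ℂ) (f : HInf E) (n : ℕ) :
    HInf.taylor (c • f) n = c • HInf.taylor f n :=
  Hb.ext fun x => by
    rw [taylor_apply, extend_smul, taylorCoeff_smul]
    rfl

theorem HInf.taylor_mul (f g : HInf E) (n : ℕ) : HInf.taylor (f * g) n =
    ∑ p ∈ Finset.HasAntidiagonal.antidiagonal n, HInf.taylor f p.1 * HInf.taylor g p.2 :=
  Hb.ext fun x => by
    rw [taylor_apply, extend_mul, taylorCoeff_mul one_pos (HInf.differentiableOn_extend f)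
      (HInf.differentiableOn_extend g), Hb.sum_apply, Finset.sum_apply]
    rfl

theorem extend_restrictBall (f : Hb E) {x : E} (hx : x ∈ ball (0 : E) 1) :
    HInf.extend (restrictBall E f) x = f x := HInf.extend_of_mem _ hx

theorem taylor_restrictBall_apply (f : Hb E) (n : ℕ) (x : E) :
    HInf.taylor (restrictBall E f) n x = taylorCoeff f n x :=
  congrFun (taylorCoeff_congr one_pos (fun _ hx => extend_restrictBall f hx) n) x

theorem restrictBall_norm_le_supOn (f : Hb E) : ‖restrictBall E f‖ ≤ supOn (ball (0 : E) 1) f :=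
  HInf.norm_le_of_extend (supOn_nonneg _ _) fun x hx => by
    rw [extend_restrictBall f hx]
    exact f.norm_le_supOn isBounded_ball hx

theorem HInf.norm_extend_le_supOn (f : HInf E) {t : ℝ} (ht0 : 0 < t) (ht1 : t ≤ 1) {x : E}
    (hx : x ∈ ball (0 : E) t) :
    ‖HInf.extend f x‖ ≤ supOn {x : ball (0 : E) 1 | (x : E) ∈ t • ball (0 : E) 1} f.1 := by
  have hx1 : x ∈ ball (0 : E) 1 := ball_subset_ball ht1 hx
  rw [HInf.extend_of_mem f hx1]
  refine le_csSup ⟨‖f‖, ?_⟩ ⟨⟨x, hx1⟩, ?_, rfl⟩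
  · rintro _ ⟨z, -, rfl⟩
    exact f.1.norm_coe_le_norm z
  · change x ∈ t • ball (0 : E) 1
    rwa [smul_unitBall_of_pos ht0]

end HInfAPI

/-! ### Removing constants by taking powers -/

section PowerTrick

theorem le_of_forall_pow_succ_le_mul_pow {a b C : ℝ} (hb : 0 ≤ b)
    (h : ∀ n : ℕ, a ^ (n + 1) ≤ C * b ^ (n + 1)) : a ≤ b := by
  by_contra! hlt
  rcases hb.eq_or_lt with rfl | hb
  · have := h 0
    simp at this
    linarith
  -- The maximum with 1 rules out the exponent 0, about which the hypothesis says nothing.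
  obtain ⟨n, hn⟩ := pow_unbounded_of_one_lt (max C 1) ((one_lt_div hb).2 hlt)
  cases n with
  | zero => simp at hn
  | succ n =>
    have := (le_max_left C 1).trans_lt hn
    rw [div_pow, lt_div_iff₀ (by positivity)] at this
    exact (h n).not_gt this

/-- Only positive exponents: the homomorphisms are not assumed unital. -/
theorem map_pow_succ {A B : Type*} [Monoid A] [Monoid B] {φ : A → B}
    (h : ∀ a b, φ (a * b) = φ a * φ b) (a : A) (n : ℕ) : φ (a ^ (n + 1)) = φ a ^ (n + 1) := by
  induction n with
  | zero => simp
  | succ n ih => rw [pow_succ, h, ih, ← pow_succ]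

end PowerTrick

/-! ### Radii, and injectivity of the restriction map below radius 1 -/

section Radius

variable {X Y : Type*} [NormedAddCommGroup X] [NormedSpace ℂ X]
  [NormedAddCommGroup Y] [NormedSpace ℂ Y]

theorem norm_extend_pow_eq (Φ : Hb X →ₙₐ[ℂ] HInf Y) (f : Hb X) (y : Y) (n : ℕ) :
    ‖HInf.extend (Φ (f ^ (n + 1))) y‖ = ‖HInf.extend (Φ f) y‖ ^ (n + 1) := by
  rw [map_pow_succ (φ := fun f => HInf.extend (Φ f) y)
    (fun a b => by rw [map_mul, HInf.extend_mul]; rfl), norm_pow]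

theorem supOn_pow_le {α : Type*} {s : Set α} {f : α → ℂ} (n : ℕ)
    (hf : BddAbove ((fun x => ‖f x‖) '' s)) : supOn s (f ^ n) ≤ supOn s f ^ n :=
  supOn_le (pow_nonneg (supOn_nonneg _ _) _) fun x hx => by
    rw [Pi.pow_apply, norm_pow]
    exact pow_le_pow_left₀ (norm_nonneg _) (le_csSup hf ⟨x, hx, rfl⟩) n

theorem Hb.coe_pow (f : Hb X) (n : ℕ) : ((f ^ n : Hb X) : X → ℂ) = (f : X → ℂ) ^ n :=
  map_pow (HbSubalgebra X).val f n

/-- Evaluation of Φ at y is multiplicative, so testing on powers of f washes out C. This reconciles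
the two notions of radius, of which only one allows a constant. -/
theorem norm_le_supOn_of_le_mul {Φ : Hb X →ₙₐ[ℂ] HInf Y} {s : Set X} {C : ℝ} (hs : IsBounded s)
    (hC : 0 ≤ C) (h : ∀ f, ‖Φ f‖ ≤ C * supOn s f) (f : Hb X) : ‖Φ f‖ ≤ supOn s f := by
  refine HInf.norm_le_of_extend (supOn_nonneg _ _) fun y _ => ?_
  refine le_of_forall_pow_succ_le_mul_pow (C := C) (supOn_nonneg _ _) fun n => ?_
  rw [← norm_extend_pow_eq]
  refine ((HInf.norm_extend_le _ y).trans (h _)).trans (mul_le_mul_of_nonneg_left ?_ hC)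
  rw [Hb.coe_pow]
  exact supOn_pow_le _ (f.bddAbove hs)

theorem Hb.supOn_mono (f : Hb X) {s t : Set X} (ht : IsBounded t) (hst : s ⊆ t) :
    supOn s f ≤ supOn t f :=
  supOn_le (supOn_nonneg _ _) fun _ hx => f.norm_le_supOn ht (hst hx)

theorem MbInf.exists_norm_le_supOn (Φ : MbInf X Y) :
    ∃ r > 0, ∀ f : Hb X, ‖Φ.1 f‖ ≤ supOn (ball (0 : X) r) f := by
  let L : Hb X →ₗ[ℂ] HInf Y :=
    { toFun := fun f => Φ.1 f
      map_add' := fun f g => map_add _ _ _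
      map_smul' := fun c f => map_smul _ _ _ }
  have hc : Continuous ((normSeminorm ℂ (HInf Y)).comp L) := continuous_norm.comp Φ.2.1
  obtain ⟨s, C, -, hb⟩ := Seminorm.bound_of_continuous (Hb.withSeminorms X) _ hc
  obtain ⟨R, hR⟩ := s.exists_le
  refine ⟨R.1, R.2, norm_le_supOn_of_le_mul isBounded_ball C.2 fun f => (hb f).trans ?_⟩
  refine mul_le_mul_of_nonneg_left ?_ C.2
  refine Seminorm.finset_sup_apply_le (supOn_nonneg _ _) fun i hi => ?_
  exact f.supOn_mono isBounded_ball (ball_subset_ball (hR i hi))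

theorem MbInf.norm_le_supOn_of_radius_lt {Φ : MbInf X Y} {r : ℝ} (hr : Φ.radius < r) (f : Hb X) :
    ‖Φ.1 f‖ ≤ supOn (ball (0 : X) r) f := by
  -- Continuity makes the set defining the radius nonempty; otherwise its infimum would be the
  -- default value 0.
  obtain ⟨s, hs, h⟩ := Φ.exists_norm_le_supOn
  obtain ⟨q, ⟨hq, hqb⟩, hqr⟩ := exists_lt_of_csInf_lt
    (s := {r : ℝ | 0 < r ∧ ∀ f : Hb X, ‖Φ.1 f‖ ≤ supOn (r • ball (0 : X) 1) f})
    ⟨s, hs, fun f => by rw [smul_unitBall_of_pos hs]; exact h f⟩ hr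
  rw [smul_unitBall_of_pos hq] at hqb
  exact (hqb f).trans (f.supOn_mono isBounded_ball (ball_subset_ball hqr.le))

theorem MbInf.radius_nonneg (Φ : MbInf X Y) : 0 ≤ Φ.radius :=
  Real.sInf_nonneg fun _ hr => hr.1.le

theorem MbInf.radius_le {Φ : MbInf X Y} {r : ℝ} (hr : 0 < r)
    (h : ∀ f : Hb X, ‖Φ.1 f‖ ≤ supOn (ball (0 : X) r) f) : Φ.radius ≤ r :=
  csInf_le ⟨0, fun _ hr => hr.1.le⟩ ⟨hr, by rwa [smul_unitBall_of_pos hr]⟩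

theorem MInf.radius_le {Ψ : MInf X Y} {r C : ℝ} (hr : 0 ≤ r) (hr1 : r ≤ 1)
    (h : ∀ f : HInf X, ‖Ψ.1 f‖ ≤
      C * supOn {x : ball (0 : X) 1 | (x : X) ∈ r • ball (0 : X) 1} f.1) : Ψ.radius ≤ r :=
  csInf_le ⟨0, fun _ hr => hr.1⟩ ⟨hr, hr1, C, h⟩

theorem MInf.exists_norm_le_of_radius_lt_one {Ψ : MInf X Y} (hΨ : Ψ.radius < 1) :
    ∃ r C : ℝ, 0 < r ∧ r < 1 ∧ 0 ≤ C ∧ ∀ (f : HInf X) (M : ℝ), 0 ≤ M →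
      (∀ x ∈ ball (0 : X) r, ‖HInf.extend f x‖ ≤ M) → ‖Ψ.1 f‖ ≤ C * M := by
  obtain ⟨q, ⟨hq0, hq1, C, h⟩, hlt⟩ := exists_lt_of_csInf_lt
    (s := {r : ℝ | 0 ≤ r ∧ r ≤ 1 ∧ ∃ C : ℝ, ∀ f : HInf X,
      ‖Ψ.1 f‖ ≤ C * supOn {x : ball (0 : X) 1 | (x : X) ∈ r • ball (0 : X) 1} f.1})
    ⟨1, zero_le_one, le_rfl, 1, fun f => by
      rw [one_mul]
      refine (norm_hom_apply_le Ψ.1 f).trans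
        (HInf.norm_le_of_extend (supOn_nonneg _ _) fun x hx => ?_)
      exact HInf.norm_extend_le_supOn f one_pos le_rfl hx⟩ hΨ
  -- The admissible q may be 0, where the set is {0}; the midpoint of q and 1 is positive, and its
  -- ball contains q • B_X in all cases.
  refine ⟨(q + 1) / 2, max C 0, by linarith, by linarith, le_max_right _ _, fun f M hM hf => ?_⟩
  refine (h f).trans (mul_le_mul (le_max_left _ _) (supOn_le hM fun x hx => ?_)
    (supOn_nonneg _ _) (le_max_right _ _))
  rw [← HInf.extend_coe f]
  refine hf _ ?_
  obtain ⟨z, hz, hzx⟩ := hx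
  change q • z = x at hzx
  rw [mem_ball_zero_iff] at hz ⊢
  rw [← hzx, norm_smul, Real.norm_of_nonneg hq0]
  nlinarith

theorem MInf.radius_rho_le_one (Ψ : MInf X Y) : (rho Ψ).radius ≤ 1 :=
  MbInf.radius_le one_pos fun f =>
    (norm_hom_apply_le Ψ.1 _).trans (restrictBall_norm_le_supOn f)

theorem MInf.radius_rho_lt_one {Ψ : MInf X Y} (hΨ : Ψ.radius < 1) : (rho Ψ).radius < 1 := by
  obtain ⟨r, C, hr, hr1, hC, h⟩ := MInf.exists_norm_le_of_radius_lt_one hΨ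
  refine (MbInf.radius_le hr (norm_le_supOn_of_le_mul isBounded_ball hC fun f => ?_)).trans_lt hr1
  refine h _ _ (supOn_nonneg _ _) fun x hx => ?_
  exact (congrArg norm (extend_restrictBall f (ball_subset_ball hr1.le hx))).trans_le
    (f.norm_le_supOn isBounded_ball hx)

theorem HInf.norm_sub_sum_restrictBall_taylor_le (f : HInf X) {r : ℝ} (hr1 : r < 1)
    (n : ℕ) {x : X} (hx : x ∈ ball (0 : X) r) :
    ‖HInf.extend (f - ∑ k ∈ Finset.range n, restrictBall X (HInf.taylor f k)) x‖ ≤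
      ‖f‖ * r ^ n / (1 - r) := by
  have hx1 : x ∈ ball (0 : X) 1 := ball_subset_ball hr1.le hx
  rw [extend_sub, extend_sum, Pi.sub_apply, Finset.sum_apply,
    Finset.sum_congr rfl fun k _ => extend_restrictBall (HInf.taylor f k) hx1]
  refine (norm_sub_sum_taylorCoeff_le (HInf.differentiableOn_extend f)
    (fun x _ => HInf.norm_extend_le f x) hx1 n).trans ?_
  rw [mem_ball_zero_iff] at hx
  have hf := norm_nonneg f
  have hr := (norm_nonneg x).trans hx.le
  have hx1 : 0 < 1 - r := by linarith
  rw [div_one]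
  gcongr

/-- Ψ is continuous for the supremum over some r B_X with r < 1, where the Taylor series of f
converges uniformly. The left side involves only `rho Ψ`, whence injectivity. -/
theorem MInf.tendsto_sum_rho_taylor {Ψ : MInf X Y} (hΨ : Ψ.radius < 1) (f : HInf X) :
    Tendsto (fun n => ∑ k ∈ Finset.range n, (rho Ψ).1 (HInf.taylor f k)) atTop (𝓝 (Ψ.1 f)) := by
  obtain ⟨r, C, hr, hr1, hC, h⟩ := MInf.exists_norm_le_of_radius_lt_one hΨ
  rw [tendsto_iff_norm_sub_tendsto_zero]
  have hlim : ∀ M : ℝ, Tendsto (fun n : ℕ => C * (M * r ^ n / (1 - r))) atTop (𝓝 0) := fun M => by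
    simpa using (((tendsto_pow_atTop_nhds_zero_of_lt_one hr.le hr1).const_mul M).div_const
      (1 - r)).const_mul C
  refine squeeze_zero (fun n => norm_nonneg _) (fun n => ?_) (hlim ‖f‖)
  rw [norm_sub_rev]
  have h1 := h (f - ∑ k ∈ Finset.range n, restrictBall X (HInf.taylor f k)) (‖f‖ * r ^ n / (1 - r))
    (div_nonneg (by positivity) (by linarith))
    fun x hx => HInf.norm_sub_sum_restrictBall_taylor_le f hr1 n hx
  rwa [map_sub, map_sum] at h1

theorem injOn_rho : InjOn (rho (X := X) (Y := Y)) {Ψ | Ψ.radius < 1} := by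
  intro Ψ₁ h₁ Ψ₂ h₂ heq
  refine Subtype.ext (NonUnitalAlgHom.ext fun f => ?_)
  have h := MInf.tendsto_sum_rho_taylor h₁ f
  rw [heq] at h
  exact tendsto_nhds_unique h (MInf.tendsto_sum_rho_taylor h₂ f)

end Radius

/-! ### Extending homomorphisms of radius at most 1 by Abel summation -/

section Extension

variable {X Y : Type*} [NormedAddCommGroup X] [NormedSpace ℂ X]
  [NormedAddCommGroup Y] [NormedSpace ℂ Y]

/-- The values at `y` of the images under `Φ` of the Taylor polynomials of `f`. -/
noncomputable def MbInf.taylorValue (Φ : MbInf X Y) (f : HInf X) (y : Y) (n : ℕ) : ℂ :=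
  HInf.extend (Φ.1 (HInf.taylor f n)) y

/-- Cauchy's estimate on t B_X, evaluated on r B_X. The case t = 1 serves contractivity; r < t gives
geometric decay controlled by f on t B_X alone. -/
theorem MbInf.norm_taylorValue_le_mul_pow {Φ : MbInf X Y} {f : HInf X} {r t M : ℝ}
    (hr : Φ.radius < r) (ht : 0 < t) (ht1 : t ≤ 1)
    (hM : ∀ x ∈ ball (0 : X) t, ‖HInf.extend f x‖ ≤ M) (y : Y) (n : ℕ) :
    ‖Φ.taylorValue f y n‖ ≤ M * (r / t) ^ n := by
  have hr0 : 0 ≤ r := Φ.radius_nonneg.trans hr.le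
  have hM0 : 0 ≤ M := (norm_nonneg _).trans (hM 0 (mem_ball_self ht))
  refine (HInf.norm_extend_le _ y).trans ((MbInf.norm_le_supOn_of_radius_lt hr _).trans ?_)
  refine supOn_le (by positivity) fun x hx => ?_
  refine (norm_taylorCoeff_le ht ((HInf.differentiableOn_extend f).mono (ball_subset_ball ht1))
    hM n x).trans ?_
  have := (mem_ball_zero_iff.1 hx).le
  gcongr

/-- For fixed n, the factor rⁿ disappears as r ↓ 1. -/
theorem MbInf.norm_taylorValue_le {Φ : MbInf X Y} (hΦ : Φ.radius ≤ 1) (f : HInf X) (y : Y)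
    (n : ℕ) : ‖Φ.taylorValue f y n‖ ≤ ‖f‖ := by
  have hlim : ∀ M : ℝ, Tendsto (fun r : ℝ => M * (r / 1) ^ n) (𝓝[>] 1) (𝓝 M) := fun M =>
    (Continuous.tendsto' (by fun_prop) _ _ (by simp)).mono_left nhdsWithin_le_nhds
  exact ge_of_tendsto (hlim ‖f‖) (eventually_nhdsWithin_of_forall fun r (hr : 1 < r) =>
    norm_taylorValue_le_mul_pow (hΦ.trans_lt hr) one_pos le_rfl
      (fun x _ => HInf.norm_extend_le f x) y n)

/-- The Abel means of the series of the values at `y` of the images under `Φ` of the Taylor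
polynomials of `f`. -/
noncomputable def MbInf.abelMean (Φ : MbInf X Y) (s : ℝ) (f : HInf X) (y : Y) : ℂ :=
  ∑' n, Φ.taylorValue f y n * (s : ℂ) ^ n

theorem norm_mul_pow_le {a : ℂ} {M s : ℝ} (hs : 0 ≤ s) (ha : ‖a‖ ≤ M) (n : ℕ) :
    ‖a * (s : ℂ) ^ n‖ ≤ M * s ^ n := by
  rw [norm_mul, norm_pow, Complex.norm_of_nonneg hs]
  gcongr

theorem MbInf.summable_norm_taylorValue {Φ : MbInf X Y} (hΦ : Φ.radius ≤ 1) {s : ℝ}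
    (hs : s ∈ Ioo (0 : ℝ) 1) (f : HInf X) (y : Y) :
    Summable fun n => ‖Φ.taylorValue f y n * (s : ℂ) ^ n‖ :=
  .of_nonneg_of_le (fun _ => norm_nonneg _)
    (fun n => norm_mul_pow_le hs.1.le (norm_taylorValue_le hΦ f y n) n)
    ((summable_geometric_of_lt_one hs.1.le hs.2).mul_left ‖f‖)

theorem MbInf.hasSum_abelMean {Φ : MbInf X Y} (hΦ : Φ.radius ≤ 1) {s : ℝ}
    (hs : s ∈ Ioo (0 : ℝ) 1) (f : HInf X) (y : Y) :
    HasSum (fun n => Φ.taylorValue f y n * (s : ℂ) ^ n) (Φ.abelMean s f y) :=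
  (summable_norm_taylorValue hΦ hs f y).of_norm.hasSum

theorem MbInf.abelMean_add {Φ : MbInf X Y} (hΦ : Φ.radius ≤ 1) {s : ℝ} (hs : s ∈ Ioo (0 : ℝ) 1)
    (f g : HInf X) (y : Y) : Φ.abelMean s (f + g) y = Φ.abelMean s f y + Φ.abelMean s g y := by
  refine (hasSum_abelMean hΦ hs (f + g) y).unique ?_
  convert (hasSum_abelMean hΦ hs f y).add (hasSum_abelMean hΦ hs g y) using 2 with n
  rw [taylorValue, HInf.taylor_add, map_add, HInf.extend_add, Pi.add_apply, add_mul]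
  rfl

theorem MbInf.abelMean_smul (Φ : MbInf X Y) (s : ℝ) (c : ℂ) (f : HInf X) (y : Y) :
    Φ.abelMean s (c • f) y = c * Φ.abelMean s f y := by
  rw [abelMean, abelMean, ← tsum_mul_left]
  congr 1 with n
  rw [taylorValue, HInf.taylor_smul, map_smul, HInf.extend_smul, Pi.smul_apply, smul_eq_mul,
    mul_assoc]
  rfl

theorem MbInf.taylorValue_mul (Φ : MbInf X Y) (f g : HInf X) (y : Y) (n : ℕ) :
    Φ.taylorValue (f * g) y n = ∑ p ∈ Finset.HasAntidiagonal.antidiagonal n,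
      Φ.taylorValue f y p.1 * Φ.taylorValue g y p.2 := by
  rw [taylorValue, HInf.taylor_mul, map_sum, HInf.extend_sum, Finset.sum_apply]
  refine Finset.sum_congr rfl fun p _ => ?_
  rw [map_mul, HInf.extend_mul]
  rfl

theorem MbInf.abelMean_mul {Φ : MbInf X Y} (hΦ : Φ.radius ≤ 1) {s : ℝ} (hs : s ∈ Ioo (0 : ℝ) 1)
    (f g : HInf X) (y : Y) : Φ.abelMean s (f * g) y = Φ.abelMean s f y * Φ.abelMean s g y := by
  rw [abelMean, abelMean, abelMean, tsum_mul_tsum_eq_tsum_sum_antidiagonal_of_summable_norm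
    (summable_norm_taylorValue hΦ hs f y) (summable_norm_taylorValue hΦ hs g y)]
  congr 1 with n
  rw [taylorValue_mul, Finset.sum_mul]
  refine Finset.sum_congr rfl fun p hp => ?_
  rw [← Finset.HasAntidiagonal.mem_antidiagonal.1 hp, pow_add]
  ring

/-- Termwise summation only gives ‖f‖/(1 − s), which blows up as s → 1; multiplicativity and the
power trick remove the factor. -/
theorem MbInf.norm_abelMean_le {Φ : MbInf X Y} (hΦ : Φ.radius ≤ 1) {s : ℝ}
    (hs : s ∈ Ioo (0 : ℝ) 1) (f : HInf X) (y : Y) : ‖Φ.abelMean s f y‖ ≤ ‖f‖ := by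
  have hbd : ∀ g : HInf X, ‖Φ.abelMean s g y‖ ≤ ‖g‖ * (1 - s)⁻¹ := fun g =>
    tsum_of_norm_bounded ((hasSum_geometric_of_lt_one hs.1.le hs.2).mul_left ‖g‖)
      fun n => norm_mul_pow_le hs.1.le (norm_taylorValue_le hΦ g y n) n
  refine le_of_forall_pow_succ_le_mul_pow (C := (1 - s)⁻¹) (norm_nonneg f) fun n => ?_
  rw [← norm_pow, ← map_pow_succ (φ := fun f => Φ.abelMean s f y)
    fun f g => abelMean_mul hΦ hs f g y, mul_comm]
  have h1 : 0 ≤ (1 - s)⁻¹ := inv_nonneg.2 (by linarith [hs.2])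
  exact (hbd _).trans (mul_le_mul_of_nonneg_right (norm_pow_le' f n.succ_pos) h1)

theorem MbInf.differentiableOn_abelMean {Φ : MbInf X Y} (hΦ : Φ.radius ≤ 1) {s : ℝ}
    (hs : s ∈ Ioo (0 : ℝ) 1) (f : HInf X) :
    DifferentiableOn ℂ (Φ.abelMean s f) (ball 0 1) := by
  refine differentiableOn_of_tendsto_of_norm_le (l := atTop) (M := ‖f‖ * (1 - s)⁻¹)
    (F := fun N y => ∑ n ∈ Finset.range N, Φ.taylorValue f y n * (s : ℂ) ^ n) isOpen_ball
    (.of_forall fun N => ⟨.fun_sum fun n _ => .mul_const (HInf.differentiableOn_extend _) _,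
      fun y _ => ?_⟩) fun y _ => (hasSum_abelMean hΦ hs f y).tendsto_sum_nat
  refine (norm_sum_le_of_le _ fun n _ =>
    norm_mul_pow_le hs.1.le (norm_taylorValue_le hΦ f y n) n).trans ?_
  have hg := (hasSum_geometric_of_lt_one hs.1.le hs.2).mul_left ‖f‖
  exact sum_le_hasSum _ (fun n _ => mul_nonneg (norm_nonneg _) (pow_nonneg hs.1.le n)) hg

/-- An ultrafilter converging to `1` from the left. -/
noncomputable def leftUltrafilter : Ultrafilter ℝ := Ultrafilter.of (𝓝[<] 1)

theorem leftUltrafilter_le : (leftUltrafilter : Filter ℝ) ≤ 𝓝[<] 1 := Ultrafilter.of_le _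

theorem eventually_leftUltrafilter : ∀ᶠ s in (leftUltrafilter : Filter ℝ), s ∈ Ioo (0 : ℝ) 1 :=
  leftUltrafilter_le (Ioo_mem_nhdsLT one_pos)

/-- The limit of the Abel means along an ultrafilter. -/
noncomputable def MbInf.abelLimit (Φ : MbInf X Y) (f : HInf X) (y : Y) : ℂ :=
  limUnder (leftUltrafilter : Filter ℝ) fun s => Φ.abelMean s f y

/-- The means lie in a compact disc. As the ultrafilter is the same for all f and y, sums, products
and holomorphy pass to the limit. -/
theorem MbInf.tendsto_abelMean {Φ : MbInf X Y} (hΦ : Φ.radius ≤ 1) (f : HInf X) (y : Y) :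
    Tendsto (fun s => Φ.abelMean s f y) leftUltrafilter (𝓝 (Φ.abelLimit f y)) := by
  refine tendsto_nhds_limUnder ?_
  obtain ⟨M, hM⟩ : ∃ M : ℝ, ∀ᶠ s in (leftUltrafilter : Filter ℝ), ‖Φ.abelMean s f y‖ ≤ M :=
    ⟨‖f‖, eventually_leftUltrafilter.mono fun _ hs => norm_abelMean_le hΦ hs f y⟩
  obtain ⟨z, -, hz⟩ := (isCompact_closedBall (0 : ℂ) M).ultrafilter_le_nhds
    (leftUltrafilter.map fun s => Φ.abelMean s f y) (by
      rw [le_principal_iff]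
      change ∀ᶠ s in (leftUltrafilter : Filter ℝ), Φ.abelMean s f y ∈ _
      filter_upwards [hM] with s hs
      exact mem_closedBall_zero_iff.2 hs)
  exact ⟨z, hz⟩

theorem MbInf.norm_abelLimit_le {Φ : MbInf X Y} (hΦ : Φ.radius ≤ 1) (f : HInf X) (y : Y) :
    ‖Φ.abelLimit f y‖ ≤ ‖f‖ :=
  le_of_tendsto (tendsto_abelMean hΦ f y).norm
    (eventually_leftUltrafilter.mono fun _ hs => norm_abelMean_le hΦ hs f y)

theorem MbInf.differentiableOn_abelLimit {Φ : MbInf X Y} (hΦ : Φ.radius ≤ 1) (f : HInf X) :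
    DifferentiableOn ℂ (Φ.abelLimit f) (ball 0 1) :=
  differentiableOn_of_tendsto_of_norm_le isOpen_ball
    (eventually_leftUltrafilter.mono fun _ hs =>
      ⟨differentiableOn_abelMean hΦ hs f, fun y _ => norm_abelMean_le hΦ hs f y⟩)
    fun y _ => tendsto_abelMean hΦ f y

/-- The extension to `H^∞(B_X)` of a homomorphism on `H_b(X)` of radius at most `1`. -/
noncomputable def MbInf.extension (Φ : MbInf X Y) (hΦ : Φ.radius ≤ 1) :
    HInf X →ₙₐ[ℂ] HInf Y where
  toFun f := HInf.ofBound (Φ.abelLimit f) ‖f‖ (differentiableOn_abelLimit hΦ f)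
    (norm_abelLimit_le hΦ f)
  map_smul' c f := HInf.ext_of_extend fun y hy => by
    rw [MonoidHom.id_apply, HInf.extend_smul, Pi.smul_apply, HInf.extend_ofBound hy,
      HInf.extend_ofBound hy]
    refine tendsto_nhds_unique (tendsto_abelMean hΦ (c • f) y) ?_
    simp only [abelMean_smul]
    exact (tendsto_abelMean hΦ f y).const_mul c
  map_zero' := HInf.ext_of_extend fun y hy => by
    have h := norm_abelLimit_le hΦ (0 : HInf X) y
    rw [norm_zero, norm_le_zero_iff] at h
    rw [HInf.extend_ofBound hy, h, HInf.extend_of_mem _ hy]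
    rfl
  map_add' f g := HInf.ext_of_extend fun y hy => by
    rw [HInf.extend_add, Pi.add_apply, HInf.extend_ofBound hy, HInf.extend_ofBound hy,
      HInf.extend_ofBound hy]
    refine tendsto_nhds_unique (tendsto_abelMean hΦ (f + g) y)
      (((tendsto_abelMean hΦ f y).add (tendsto_abelMean hΦ g y)).congr' ?_)
    filter_upwards [eventually_leftUltrafilter] with s hs using (abelMean_add hΦ hs f g y).symm
  map_mul' f g := HInf.ext_of_extend fun y hy => by
    rw [HInf.extend_mul, Pi.mul_apply, HInf.extend_ofBound hy, HInf.extend_ofBound hy,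
      HInf.extend_ofBound hy]
    refine tendsto_nhds_unique (tendsto_abelMean hΦ (f * g) y)
      (((tendsto_abelMean hΦ f y).mul (tendsto_abelMean hΦ g y)).congr' ?_)
    filter_upwards [eventually_leftUltrafilter] with s hs using (abelMean_mul hΦ hs f g y).symm

theorem MbInf.extend_extension {Φ : MbInf X Y} (hΦ : Φ.radius ≤ 1) (f : HInf X) {y : Y}
    (hy : y ∈ ball (0 : Y) 1) : HInf.extend (Φ.extension hΦ f) y = Φ.abelLimit f y :=
  HInf.extend_of_mem _ hy

/-- Φ is controlled by the supremum over 2 B_X, since its radius is below 2. There the Taylor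
remainder of f, which is bounded on 4 B_X, is of order 2⁻ᴺ. -/
theorem MbInf.tendsto_sum_taylorValue_restrictBall {Φ : MbInf X Y} (hΦ : Φ.radius ≤ 1) (f : Hb X)
    (y : Y) : Tendsto (fun N => ∑ n ∈ Finset.range N, Φ.taylorValue (restrictBall X f) y n) atTop
      (𝓝 (HInf.extend (Φ.1 f) y)) := by
  rw [tendsto_iff_norm_sub_tendsto_zero]
  have hlim : Tendsto (fun N : ℕ => supOn (ball (0 : X) 4) f * (1 / 2) ^ N / (1 - 1 / 2)) atTop
      (𝓝 0) := by
    have h := tendsto_pow_atTop_nhds_zero_of_lt_one (r := (1 / 2 : ℝ)) (by norm_num) (by norm_num)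
    simpa using (h.const_mul (supOn (ball (0 : X) 4) f)).div_const (1 - 1 / 2)
  refine squeeze_zero (fun N => norm_nonneg _) (fun N => ?_) hlim
  have hsum : HInf.extend (Φ.1 f) y -
      ∑ n ∈ Finset.range N, Φ.taylorValue (restrictBall X f) y n =
      HInf.extend (Φ.1 (f - ∑ n ∈ Finset.range N, HInf.taylor (restrictBall X f) n)) y := by
    rw [map_sub, map_sum, HInf.extend_sub, HInf.extend_sum, Pi.sub_apply, Finset.sum_apply]
    rfl
  rw [norm_sub_rev, hsum]
  refine (HInf.norm_extend_le _ y).trans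
    ((norm_le_supOn_of_radius_lt (r := 2) (by linarith) _).trans ?_)
  have h0 := supOn_nonneg (ball (0 : X) 4) f
  refine supOn_le (div_nonneg (by positivity) (by norm_num)) fun x hx => ?_
  rw [Hb.sub_apply, Hb.sum_apply, Finset.sum_congr rfl fun n _ => taylor_restrictBall_apply f n x]
  refine (norm_sub_sum_taylorCoeff_le f.2.1.differentiableOn
    (fun x hx => f.norm_le_supOn isBounded_ball hx)
    (ball_subset_ball (by norm_num : (2 : ℝ) ≤ 4) hx) N).trans ?_
  have hq : ‖x‖ / 4 ≤ 1 / 2 := by linarith [mem_ball_zero_iff.1 hx]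
  gcongr

theorem MbInf.extension_restrictBall {Φ : MbInf X Y} (hΦ : Φ.radius ≤ 1) (f : Hb X) :
    Φ.extension hΦ (restrictBall X f) = Φ.1 f := by
  refine HInf.ext_of_extend fun y hy => ?_
  rw [extend_extension hΦ _ hy]
  refine tendsto_nhds_unique (tendsto_abelMean hΦ _ y) ?_
  -- Abel's limit theorem: the series converges in the ordinary sense, so the ultrafilter limit
  -- equals its sum.
  have h := Complex.tendsto_tsum_powerSeries_nhdsWithin_lt
    (tendsto_sum_taylorValue_restrictBall hΦ f y)
  rw [tendsto_map'_iff] at h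
  exact h.mono_left leftUltrafilter_le

theorem MbInf.exists_rho_eq (Φ : MbInf X Y) (hΦ : Φ.radius ≤ 1) :
    ∃ Ψ : MInf X Y, Ψ.1 = Φ.extension hΦ ∧ rho Ψ = Φ := by
  refine ⟨⟨Φ.extension hΦ, fun h => Φ.2.2 (NonUnitalAlgHom.ext fun f => ?_)⟩, rfl,
    Subtype.ext (NonUnitalAlgHom.ext fun f => extension_restrictBall hΦ f)⟩
  rw [← extension_restrictBall hΦ f, h]
  rfl

/-- The terms are dominated by a geometric series of ratio r/t, uniformly in s, so the bound
survives s → 1. -/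
theorem MbInf.norm_extension_le {Φ : MbInf X Y} (hΦ : Φ.radius ≤ 1) {r t : ℝ}
    (hr : Φ.radius < r) (hrt : r < t) (ht1 : t ≤ 1) (f : HInf X) :
    ‖Φ.extension hΦ f‖ ≤ (1 - r / t)⁻¹ *
      supOn {x : ball (0 : X) 1 | (x : X) ∈ t • ball (0 : X) 1} f.1 := by
  have hr0 : 0 ≤ r := Φ.radius_nonneg.trans hr.le
  have ht0 : 0 < t := hr0.trans_lt hrt
  have hq : r / t < 1 := (div_lt_one ht0).2 hrt
  have h0 := supOn_nonneg {x : ball (0 : X) 1 | (x : X) ∈ t • ball (0 : X) 1} f.1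
  refine HInf.norm_le_of_extend (mul_nonneg (inv_nonneg.2 (by linarith)) h0) fun y hy => ?_
  rw [extend_extension hΦ _ hy, mul_comm]
  refine le_of_tendsto (tendsto_abelMean hΦ f y).norm ?_
  filter_upwards [eventually_leftUltrafilter] with s hs
  refine tsum_of_norm_bounded ((hasSum_geometric_of_lt_one (by positivity) hq).mul_left _)
    fun n => ?_
  refine (norm_mul_pow_le hs.1.le (norm_taylorValue_le_mul_pow hr ht0 ht1
    (fun x hx => HInf.norm_extend_le_supOn f ht0 ht1 hx) y n) n).trans ?_
  exact mul_le_of_le_one_right (by positivity) (pow_le_one₀ hs.1.le hs.2.le)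

theorem MbInf.exists_radius_lt_one_rho_eq {Φ : MbInf X Y} (hΦ : Φ.radius < 1) :
    ∃ Ψ : MInf X Y, Ψ.radius < 1 ∧ rho Ψ = Φ := by
  obtain ⟨Ψ, hΨ, hrho⟩ := Φ.exists_rho_eq hΦ.le
  obtain ⟨r, hr, hr1⟩ := exists_between hΦ
  obtain ⟨t, hrt, ht1⟩ := exists_between hr1
  have ht0 : 0 ≤ t := (Φ.radius_nonneg.trans hr.le).trans hrt.le
  refine ⟨Ψ, (MInf.radius_le (C := (1 - r / t)⁻¹) ht0 ht1.le fun f => ?_).trans_lt ht1, hrho⟩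
  rw [hΨ]
  exact norm_extension_le hΦ.le hr hrt ht1.le f

end Extension

end VectorSpectrum

end

theorem mainTheorem9 {X Y : Type*}
    [NormedAddCommGroup X] [NormedSpace ℂ X] [CompleteSpace X]
    [NormedAddCommGroup Y] [NormedSpace ℂ Y] [CompleteSpace Y] :
    Set.range (VectorSpectrum.rho (X := X) (Y := Y)) =
        {Φ : VectorSpectrum.MbInf X Y | Φ.radius ≤ 1} ∧
      Set.BijOn (VectorSpectrum.rho (X := X) (Y := Y))
        {Ψ : VectorSpectrum.MInf X Y | Ψ.radius < 1}
        {Φ : VectorSpectrum.MbInf X Y | Φ.radius < 1} := by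
  refine ⟨Set.Subset.antisymm ?_ fun Φ hΦ => ?_, fun Ψ hΨ => ?_, VectorSpectrum.injOn_rho,
    fun Φ hΦ => VectorSpectrum.MbInf.exists_radius_lt_one_rho_eq hΦ⟩
  · rintro _ ⟨Ψ, rfl⟩
    exact VectorSpectrum.MInf.radius_rho_le_one Ψ
  · obtain ⟨Ψ, -, h⟩ := Φ.exists_rho_eq hΦ
    exact ⟨Ψ, h⟩
  · exact VectorSpectrum.MInf.radius_rho_lt_one hΨ
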